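/- Let $t,n_1,\dots,n_t,m_1,\dots,m_t$ be positive integers with $m_1\ge\dots\ge m_t$ and $m_i\ge n_i$ for all $i$, let $\mathbb F_q$ be the finite field with $q$ elements, and let $\mathbb M=\mathbb F_q^{m_1\times n_1}\times\dots\times\mathbb F_q^{m_t\times n_t}$, $n=n_1+\dots+n_t$. The sum-rank weight of $C=(C_1,\dots,C_t)\in\mathbb M$ is $\mathrm{srk}(C)=\sum_{i=1}^t\mathrm{rk}(C_i)$. The minimum distance of a nonzero $\mathbb F_q$-linear subspace (code) $\mathcal C\subseteq\mathbb M$ is $d(\mathcal C)=\min\{\mathrm{srk}(C): C\in\mathcal C\setminus\{0\}\}$. A nonzero code $\mathcal C\subseteq\mathbb M$ is called maximum sum-rank distance (MSRD) if there exist $k\in\{1,\dots,t\}$ and $0\le\delta\le n_k-1$ such that $$d(\mathcal C)=\sum_{i=1}^{k-1}n_i+\delta+1\quad\text{and}\quad \dim(\mathcal C)=\sum_{i=k}^{t}m_in_i-\delta m_k .$$ **Proposition.** Let $j=\min\{i\in\{1,\dots,t\} : m_i=m_t\}$ and $d=\sum_{i=1}^{j-1}n_i+1$. Suppose that $n_i\le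 m_t$ for all $i\in\{1,\dots,t\}$. If $q>t$, then there exist MSRD codes $\mathcal C_n\subseteq\dots\subseteq\mathcal C_{d+1}\subseteq\mathcal C_d\subseteq\mathbb M$ with $d(\mathcal C_i)=i$ for $d\le i\le n$. -/

import Mathlib

namespace SumRank

/-- The ambient space: the product over `i` of the spaces of `m i × n i` matrices over `F`. -/
abbrev Ambient (F : Type*) {t : ℕ} (m n : Fin t → ℕ) : Type _ :=
  ∀ i : Fin t, Matrix (Fin (m i)) (Fin (n i)) F

/-- The sum-rank weight of a tuple of matrices. -/
noncomputable def srk {F : Type*} [Field F] {t : ℕ} {m n : Fin t → ℕ}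
    (X : Ambient F m n) : ℕ :=
  ∑ i, (X i).rank

/-- The minimum distance of a (linear) code: the least sum-rank weight of a nonzero codeword.
For the zero code, which has no minimum distance, this is the junk value `0`; every nonzero
code has a positive minimum distance. -/
noncomputable def minDist {F : Type*} [Field F] {t : ℕ} {m n : Fin t → ℕ}
    (C : Submodule F (Ambient F m n)) : ℕ :=
  sInf {w : ℕ | ∃ X ∈ C, X ≠ 0 ∧ srk X = w}

/-- Maximum sum-rank distance codes: for some index `j` and some `0 ≤ δ ≤ n j - 1`, the minimum
distance is `∑_{i < j} n i + δ + 1` and the dimension is `∑_{i ≥ j} m i * n i - δ * m j`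
(the dimension formula is written without subtraction). -/
def IsMSRD {F : Type*} [Field F] {t : ℕ} {m n : Fin t → ℕ}
    (C : Submodule F (Ambient F m n)) : Prop :=
  ∃ (j : Fin t) (δ : ℕ), δ < n j ∧
    minDist C = (∑ i ∈ Finset.Iio j, n i) + δ + 1 ∧
    Module.finrank F C + δ * m j = ∑ i ∈ Finset.Ici j, (m i * n i)

end SumRank

/-!
The codes are linearized Reed–Solomon codes. Let `L / F` be the extension of degree `M = m_t`, with
Frobenius `σ`. A skew polynomial `f = ∑ f_k X^k` over `L` acts on `L` through each operator
`x ↦ a_i σ(x)`, and the `i`-th block of its codeword is the matrix of this `F`-linear map,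
restricted to an `n_i`-dimensional subspace of `L` and embedded into `F ^ m_i`. If the `a_i ≠ 0` are
pairwise not `σ`-conjugate, then the kernels of these actions have total dimension at most `deg f`:
a root yields a right factor `X - b`, whose kernel is at most one-dimensional for one `i` and
trivial for all others. So the skew polynomials of degree less than `K` give a code of
dimension `M K` and minimum distance `∑ n_i + 1 - K`, and these codes are nested. Non-conjugate
`a_i` exist because conjugate elements have the same norm to `F`, while every one of the `q - 1 ≥ t`
nonzero elements of `F` is a norm.
-/

namespace SumRank

open Module Polynomial

section SkewEval

variable {F L : Type*} [CommRing F] [CommRing L] [Algebra F L]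

/-- The `σ`-semilinear operator `x ↦ a * σ x`, at which skew polynomials are evaluated. -/
noncomputable def skewOp (σ : L →ₐ[F] L) (a : L) : Module.End F L :=
  a • σ.toLinearMap

theorem skewOp_apply (σ : L →ₐ[F] L) (a x : L) : skewOp σ a x = a * σ x := rfl

theorem skewOp_pow_mul (σ : L →ₐ[F] L) (a : L) (k : ℕ) (b x : L) :
    (skewOp σ a ^ k) (b * x) = σ^[k] b * (skewOp σ a ^ k) x := by
  induction k with
  | zero => rfl
  | succ k ih =>
    simp only [pow_succ', Module.End.mul_apply, ih, skewOp_apply, map_mul,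
      Function.iterate_succ_apply']
    ring

/-- The evaluation `∑ k, f_k • T ^ k` of the skew polynomial `f` over `L` at an operator `T`. Skew
polynomials are encoded by their coefficients, as elements of `L[X]`; their product is not the one
of `L[X]`, but it becomes composition under `skewEval (skewOp σ a)`. -/
noncomputable def skewEval (T : Module.End F L) : L[X] →ₗ[L] Module.End F L :=
  Polynomial.lsum fun k => LinearMap.toSpanSingleton L (Module.End F L) (T ^ k)

@[simp]
theorem skewEval_monomial (T : Module.End F L) (k : ℕ) (c : L) :
    skewEval T (monomial k c) = c • T ^ k := by
  simp [skewEval, Polynomial.lsum_apply]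

@[simp]
theorem skewEval_C (T : Module.End F L) (c : L) : skewEval T (C c) = c • 1 := by
  rw [← monomial_zero_left, skewEval_monomial, pow_zero]

theorem skewOp_pow_succ_eq (σ : L →ₐ[F] L) (a b : L) (k : ℕ) :
    skewOp σ a ^ (k + 1) =
      skewOp σ a ^ k * (skewOp σ a - b • 1) + σ^[k] b • skewOp σ a ^ k := by
  ext x
  simp [mul_sub, pow_succ, skewOp_pow_mul]

theorem exists_skewEval_eq_mul_sub_add (σ : L →ₐ[F] L) (b : L) (K : ℕ) (f : L[X])
    (hf : f.natDegree ≤ K + 1) :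
    ∃ (g : L[X]) (r : L), g.natDegree ≤ K ∧ g.coeff K = f.coeff (K + 1) ∧
      ∀ a, skewEval (skewOp σ a) f =
        skewEval (skewOp σ a) g * (skewOp σ a - b • 1) + r • 1 := by
  induction K generalizing f with
  | zero =>
    have hf' : f = monomial 1 (f.coeff 1) + C (f.coeff 0) := by
      rw [← C_mul_X_eq_monomial]
      exact eq_X_add_C_of_natDegree_le_one hf
    refine ⟨C (f.coeff 1), f.coeff 0 + f.coeff 1 * b, (natDegree_C _).le, coeff_C_zero, fun a => ?_⟩
    conv_lhs => rw [hf']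
    simp only [map_add, skewEval_monomial, skewEval_C, pow_one, smul_mul_assoc, one_mul]
    module
  | succ K ih =>
    set c := f.coeff (K + 2)
    have hdeg : (f.erase (K + 2) + monomial (K + 1) (c * σ^[K + 1] b)).natDegree ≤ K + 1 := by
      refine natDegree_add_le_of_degree_le ?_ (natDegree_monomial_le _)
      refine natDegree_le_iff_coeff_eq_zero.mpr fun i hi => ?_
      rw [coeff_erase]
      split_ifs with h
      · rfl
      · exact coeff_eq_zero_of_natDegree_lt (by omega)
    obtain ⟨g, r, hg, -, h⟩ := ih _ hdeg
    refine ⟨monomial (K + 1) c + g, r,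
      natDegree_add_le_of_degree_le (natDegree_monomial_le _) (hg.trans K.le_succ), ?_, fun a => ?_⟩
    · rw [coeff_add, coeff_monomial_same, coeff_eq_zero_of_natDegree_lt (by omega), add_zero]
    · -- Trade the leading term for `c X ^ (K + 1) (X - b)` and a term of lower degree.
      set A := skewOp σ a with hA
      have hquot := h a
      rw [map_add, skewEval_monomial, ← hA] at hquot
      calc skewEval A f
          = c • A ^ (K + 2) + skewEval A (f.erase (K + 2)) := by
            rw [← skewEval_monomial, ← map_add, monomial_add_erase]
        _ = c • (A ^ (K + 1) * (A - b • 1)) +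
              (skewEval A (f.erase (K + 2)) + (c * σ^[K + 1] b) • A ^ (K + 1)) := by
            rw [hA, skewOp_pow_succ_eq σ a b]
            module
        _ = skewEval A (monomial (K + 1) c + g) * (A - b • 1) + r • 1 := by
            rw [hquot, map_add, skewEval_monomial, add_mul, smul_mul_assoc, add_assoc]

end SkewEval

theorem finrank_comap_le {F V W : Type*} [Field F] [AddCommGroup V] [Module F V]
    [AddCommGroup W] [Module F W] [Module.Finite F V] [Module.Finite F W]
    (f : V →ₗ[F] W) (p : Submodule F W) :
    finrank F (p.comap f) ≤ finrank F p + finrank F (LinearMap.ker f) := by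
  let g : p.comap f →ₗ[F] p := f.restrict fun _ hx => hx
  have hker : finrank F (LinearMap.ker g) ≤ finrank F (LinearMap.ker f) := by
    rw [← Submodule.finrank_map_subtype_eq]
    refine Submodule.finrank_mono ?_
    rintro _ ⟨x, hx, rfl⟩
    exact congrArg Subtype.val hx
  rw [← g.finrank_range_add_finrank_ker]
  exact Nat.add_le_add (Submodule.finrank_le _) hker

section RootBound

variable {F L : Type*} [Field F] [Field L] [Algebra F L]

/-- The `σ`-conjugacy `b = a * σ c / c` of elements of `L`: it says that `b` is an eigenvalue of
`skewOp σ a`. -/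
def SkewConj (σ : L →ₐ[F] L) (a b : L) : Prop :=
  ∃ c ≠ 0, a * σ c = b * c

theorem mem_ker_skewOp_sub_smul {σ : L →ₐ[F] L} {a b x : L} :
    x ∈ LinearMap.ker (skewOp σ a - b • 1) ↔ a * σ x = b * x := by
  simp [skewOp_apply, sub_eq_zero]

theorem mul_map_div_eq {σ : L →ₐ[F] L} {a a' b x y : L} (hy : y ≠ 0)
    (hx : a * σ x = b * x) (hy' : a' * σ y = b * y) : a * σ (x / y) = a' * (x / y) := by
  have hσy : σ y ≠ 0 := by simpa using hy
  rw [map_div₀, mul_div_assoc', mul_div_assoc', div_eq_div_iff hσy hy]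
  linear_combination y * hx - x * hy'

theorem ker_skewOp_sub_smul_eq_bot {σ : L →ₐ[F] L} {a a' b y : L} (h : ¬ SkewConj σ a a')
    (hy : y ≠ 0) (hby : a' * σ y = b * y) : LinearMap.ker (skewOp σ a - b • 1) = ⊥ := by
  refine (Submodule.eq_bot_iff _).mpr fun x hx => ?_
  by_contra hx0
  exact h ⟨x / y, div_ne_zero hx0 hy,
    mul_map_div_eq hy (mem_ker_skewOp_sub_smul.mp hx) hby⟩

theorem finrank_ker_skewOp_sub_smul_le_one {σ : L →ₐ[F] L}
    (hσ : ∀ x, σ x = x → x ∈ Set.range (algebraMap F L)) {a : L} (ha : a ≠ 0) (b : L) :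
    finrank F (LinearMap.ker (skewOp σ a - b • 1)) ≤ 1 := by
  by_cases hbot : LinearMap.ker (skewOp σ a - b • 1) = ⊥
  · rw [hbot, finrank_bot]
    exact zero_le_one
  obtain ⟨y, hy, hy0⟩ := Submodule.exists_mem_ne_zero_of_ne_bot hbot
  refine finrank_le_one ⟨y, hy⟩ fun ⟨x, hx⟩ => ?_
  have hfix : σ (x / y) = x / y := mul_left_cancel₀ ha <|
    mul_map_div_eq hy0 (mem_ker_skewOp_sub_smul.mp hx) (mem_ker_skewOp_sub_smul.mp hy)
  obtain ⟨c, hc⟩ := hσ _ hfix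
  refine ⟨c, Subtype.ext ?_⟩
  change c • y = x
  rw [Algebra.smul_def, hc, div_mul_cancel₀ _ hy0]

theorem exists_skewEval_eq_mul_sub_of_apply_eq_zero {σ : L →ₐ[F] L} {a b y : L} {K : ℕ} {f : L[X]}
    (hf : f.natDegree = K + 1) (hy : y ≠ 0) (hby : a * σ y = b * y)
    (hfy : skewEval (skewOp σ a) f y = 0) :
    ∃ g : L[X], g ≠ 0 ∧ g.natDegree ≤ K ∧
      ∀ a', skewEval (skewOp σ a') f = skewEval (skewOp σ a') g * (skewOp σ a' - b • 1) := by
  obtain ⟨g, r, hgK, hgc, hdiv⟩ := exists_skewEval_eq_mul_sub_add σ b K f hf.le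
  have hr : r = 0 := by
    have hroot : (skewOp σ a - b • 1) y = 0 := mem_ker_skewOp_sub_smul.mpr hby
    simpa [hfy, hroot, hy] using (LinearMap.congr_fun (hdiv a) y).symm
  refine ⟨g, ?_, hgK, fun a' => by simpa [hr] using hdiv a'⟩
  rintro rfl
  rw [coeff_zero, ← hf, coeff_natDegree, eq_comm, leadingCoeff_eq_zero] at hgc
  simp [hgc] at hf

/-- The analogue for skew evaluation at the operators `T i` of the fact that a nonzero polynomial
has at most as many roots as its degree, roots being counted by the dimension of the kernels. -/
def RootBounded {ι : Type*} [Fintype ι] (T : ι → Module.End F L) : Prop :=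
  ∀ f : L[X], f ≠ 0 → ∑ i, finrank F (LinearMap.ker (skewEval (T i) f)) ≤ f.natDegree

theorem rootBounded_skewOp [Module.Finite F L] {ι : Type*} [Fintype ι] {σ : L →ₐ[F] L}
    (hσ : ∀ x, σ x = x → x ∈ Set.range (algebraMap F L)) {a : ι → L} (ha0 : ∀ i, a i ≠ 0)
    (ha : Pairwise fun i j => ¬ SkewConj σ (a i) (a j)) :
    RootBounded fun i => skewOp σ (a i) := by
  classical
  intro f hf
  beta_reduce
  induction hK : f.natDegree using Nat.strong_induction_on generalizing f with | _ N ih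
  by_cases hker : ∀ i, LinearMap.ker (skewEval (skewOp σ (a i)) f) = ⊥
  · exact (Finset.sum_eq_zero fun i _ => by rw [hker i, finrank_bot]).trans_le N.zero_le
  push Not at hker
  obtain ⟨l, hl⟩ := hker
  obtain ⟨y, hfy, hy⟩ := Submodule.exists_mem_ne_zero_of_ne_bot hl
  obtain _ | K := N
  · refine absurd hfy ?_
    rw [eq_C_of_natDegree_eq_zero hK, Ne, C_eq_zero] at hf
    rw [eq_C_of_natDegree_eq_zero hK]
    simp [hf, hy]
  have hby : a l * σ y = a l * σ y / y * y := (div_mul_cancel₀ _ hy).symm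
  obtain ⟨g, hg, hgK, hfg⟩ := exists_skewEval_eq_mul_sub_of_apply_eq_zero hK hy hby hfy
  have hlinear : ∀ i, finrank F (LinearMap.ker (skewOp σ (a i) - (a l * σ y / y) • 1)) ≤
      if i = l then 1 else 0 := by
    intro i
    split_ifs with hi
    · exact finrank_ker_skewOp_sub_smul_le_one hσ (ha0 i) _
    · rw [ker_skewOp_sub_smul_eq_bot (ha hi) hy hby, finrank_bot]
  calc ∑ i, finrank F (LinearMap.ker (skewEval (skewOp σ (a i)) f))
      ≤ ∑ i, (finrank F (LinearMap.ker (skewEval (skewOp σ (a i)) g)) + if i = l then 1 else 0) :=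
        Finset.sum_le_sum fun i _ => by
          rw [hfg, Module.End.mul_eq_comp, LinearMap.ker_comp]
          exact (finrank_comap_le _ _).trans (Nat.add_le_add_left (hlinear i) _)
    _ ≤ K + 1 := by
        rw [Finset.sum_add_distrib, Finset.sum_ite_eq' Finset.univ l, if_pos (Finset.mem_univ l)]
        have := ih _ (Nat.lt_succ_of_le hgK) g hg rfl
        omega

end RootBound

section SumRankMetric

variable {F : Type*} [Field F] {t : ℕ} {m n : Fin t → ℕ}

theorem minDist_eq_of_le {C : Submodule F (Ambient F m n)} {w : ℕ}
    (hle : ∀ X ∈ C, X ≠ 0 → w ≤ srk X) (hex : ∃ X ∈ C, X ≠ 0 ∧ srk X ≤ w) : minDist C = w := by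
  obtain ⟨X, hX, hX0, hXw⟩ := hex
  refine IsLeast.csInf_eq ⟨⟨X, hX, hX0, hXw.antisymm (hle X hX hX0)⟩, ?_⟩
  rintro _ ⟨Y, hY, hY0, rfl⟩
  exact hle Y hY hY0

theorem srk_add_card_le_of_col_eq_zero (X : Ambient F m n) (S : Finset (Σ i, Fin (n i)))
    (hS : ∀ s ∈ S, ∀ r, X s.1 r s.2 = 0) : srk X + S.card ≤ ∑ i, n i := by
  classical
  have hrank (i : Fin t) : (X i).rank ≤ (Finset.univ.filter fun c => ⟨i, c⟩ ∉ S).card := by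
    rw [← Matrix.rank_transpose]
    refine Matrix.rank_le_card_of_support_subset _ _ fun c hc => ?_
    contrapose! hc
    rw [Function.notMem_support]
    exact funext (hS ⟨i, c⟩ (by simpa using hc))
  have hcard :
      ∑ i, (Finset.univ.filter fun c => (⟨i, c⟩ : Σ i, Fin (n i)) ∉ S).card = Sᶜ.card := by
    rw [← Finset.card_sigma]
    congr 1
    ext
    simp
  calc srk X + S.card ≤ Sᶜ.card + S.card := by
        rw [← hcard]
        exact Nat.add_le_add_right (Finset.sum_le_sum fun i _ => hrank i) _
    _ = ∑ i, n i := by simp [Finset.card_compl_add_card]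

theorem exists_eq_sum_Iio_add (n : Fin t → ℕ) {w : ℕ} (hw : w < ∑ i, n i) :
    ∃ k δ, δ < n k ∧ w = ∑ i ∈ Finset.Iio k, n i + δ := by
  obtain ⟨⟨k, δ⟩, hkδ⟩ := finSigmaFinEquiv.surjective (⟨w, hw⟩ : Fin (∑ i, n i))
  refine ⟨k, δ, δ.isLt, ?_⟩
  have hIio : ∑ i : Fin k, n (i.castLE k.2.le) = ∑ i ∈ Finset.Iio k, n i := by
    refine Finset.sum_nbij (Fin.castLE k.2.le) ?_ (Fin.castLE_injective _).injOn ?_ fun _ _ => rfl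
    · simp [Fin.lt_def]
    · exact fun i hi => ⟨⟨i, by simpa using hi⟩, by simp⟩
  rw [← hIio, ← finSigmaFinEquiv_apply ⟨k, δ⟩, hkδ]

theorem sum_Iio_add_sum_Ici {ι A : Type*} [Fintype ι] [LinearOrder ι]
    [LocallyFiniteOrderBot ι] [LocallyFiniteOrderTop ι] [AddCommMonoid A] (g : ι → A) (k : ι) :
    ∑ i ∈ Finset.Iio k, g i + ∑ i ∈ Finset.Ici k, g i = ∑ i, g i := by
  rw [← Finset.sum_add_sum_compl (Finset.Iio k)]
  congr 2
  ext
  simp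

theorem isMSRD_of_finrank_add_mul_minDist {C : Submodule F (Ambient F m n)} {M : ℕ} {j : Fin t}
    (hM : ∀ i, j ≤ i → m i = M) (hj : ∑ i ∈ Finset.Iio j, n i < minDist C)
    (hle : minDist C ≤ ∑ i, n i) (hC : finrank F C + M * minDist C = M * (∑ i, n i + 1)) :
    IsMSRD C := by
  obtain ⟨k, δ, hδ, hk⟩ := exists_eq_sum_Iio_add n (w := minDist C - 1) (by omega)
  have hdist : minDist C = ∑ i ∈ Finset.Iio k, n i + δ + 1 := by omega
  have hjk : j ≤ k := by
    by_contra! hkj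
    have hIic : ∑ i ∈ Finset.Iic k, n i ≤ ∑ i ∈ Finset.Iio j, n i :=
      Finset.sum_le_sum_of_subset fun i hi =>
        Finset.mem_Iio.mpr ((Finset.mem_Iic.mp hi).trans_lt hkj)
    rw [← Finset.sum_Iio_add_eq_sum_Iic] at hIic
    omega
  have hsum : ∑ i ∈ Finset.Ici k, m i * n i = M * ∑ i ∈ Finset.Ici k, n i := by
    rw [Finset.mul_sum]
    exact Finset.sum_congr rfl fun i hi => by rw [hM i (hjk.trans (Finset.mem_Ici.mp hi))]
  refine ⟨k, δ, hδ, hdist, ?_⟩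
  rw [hdist, ← sum_Iio_add_sum_Ici n k] at hC
  rw [hsum, hM k hjk]
  linarith

end SumRankMetric

section SkewEvalCode

variable {F L : Type*} [Field F] [Field L] [Algebra F L]

theorem exists_mem_degreeLT_skewEval_apply_eq_zero {ι : Type*} [Fintype ι]
    (T : ι → Module.End F L) (x : ι → L) {K : ℕ} (hK : Fintype.card ι < K) :
    ∃ f ∈ degreeLT L K, f ≠ 0 ∧ ∀ s, skewEval (T s) f (x s) = 0 := by
  let evalAt : degreeLT L K →ₗ[L] (ι → L) :=
    LinearMap.pi fun s => LinearMap.applyₗ' L (x s) ∘ₗ skewEval (T s) ∘ₗ Submodule.subtype _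
  have hker : LinearMap.ker evalAt ≠ ⊥ := by
    have : Module.Finite L (degreeLT L K) := Module.Finite.equiv (degreeLTEquiv L K).symm
    apply LinearMap.ker_ne_bot_of_finrank_lt
    rwa [(degreeLTEquiv L K).finrank_eq, finrank_fin_fun, finrank_pi]
  obtain ⟨⟨f, hf⟩, hfx, hf0⟩ := Submodule.exists_mem_ne_zero_of_ne_bot hker
  exact ⟨f, hf, fun h => hf0 (Subtype.ext h), congrFun (LinearMap.mem_ker.mp hfx)⟩

variable {t : ℕ} {m n : Fin t → ℕ}

/-- The encoder of an evaluation code: the `i`-th block is the matrix of `skewEval (T i) f`,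
restricted along `β i : F ^ n i → L` and expanded along `e i : L → F ^ m i`. -/
noncomputable def encode (T : Fin t → Module.End F L) (β : ∀ i, (Fin (n i) → F) →ₗ[F] L)
    (e : ∀ i, L →ₗ[F] (Fin (m i) → F)) : L[X] →ₗ[F] Ambient F m n :=
  LinearMap.pi fun i => LinearMap.toMatrix'.toLinearMap ∘ₗ LinearMap.compRight F (e i) ∘ₗ
    LinearMap.lcomp F L (β i) ∘ₗ (skewEval (T i)).restrictScalars F

/-- The code of evaluations of all skew polynomials of degree less than `K`. For operators
`skewOp σ (a i)` it is a linearized Reed–Solomon code. -/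
noncomputable def skewEvalCode (T : Fin t → Module.End F L) (β : ∀ i, (Fin (n i) → F) →ₗ[F] L)
    (e : ∀ i, L →ₗ[F] (Fin (m i) → F)) (K : ℕ) : Submodule F (Ambient F m n) :=
  ((degreeLT L K).restrictScalars F).map (encode T β e)

variable {T : Fin t → Module.End F L} {β : ∀ i, (Fin (n i) → F) →ₗ[F] L}
  {e : ∀ i, L →ₗ[F] (Fin (m i) → F)}

theorem encode_apply (f : L[X]) (i : Fin t) :
    encode T β e f i = LinearMap.toMatrix' (e i ∘ₗ skewEval (T i) f ∘ₗ β i) := rfl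

theorem skewEvalCode_mono : Monotone (skewEvalCode T β e) := fun _ _ h =>
  Submodule.map_mono (degreeLT_mono h)

theorem exists_srk_encode_add_le (T : Fin t → Module.End F L) (β : ∀ i, (Fin (n i) → F) →ₗ[F] L)
    (e : ∀ i, L →ₗ[F] (Fin (m i) → F)) {K : ℕ} (hK0 : 0 < K) (hK : K ≤ ∑ i, n i) :
    ∃ f ∈ degreeLT L K, f ≠ 0 ∧ srk (encode T β e f) + K ≤ ∑ i, n i + 1 := by
  obtain ⟨S, -, hS⟩ := Finset.exists_subset_card_eq
    (s := (Finset.univ : Finset (Σ i, Fin (n i)))) (n := K - 1)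
    (by simpa using (Nat.sub_le K 1).trans hK)
  obtain ⟨f, hf, hf0, hfS⟩ := exists_mem_degreeLT_skewEval_apply_eq_zero
    (fun s : S => T s.1.1) (fun s => β s.1.1 (Pi.single s.1.2 1))
    (show Fintype.card S < K by rw [Fintype.card_coe]; omega)
  refine ⟨f, hf, hf0, ?_⟩
  have := srk_add_card_le_of_col_eq_zero (encode T β e f) S fun s hs r => by
    rw [encode_apply, LinearMap.toMatrix'_apply]
    simp [hfS ⟨s, hs⟩]
  omega

variable [Module.Finite F L]

theorem le_rank_encode_add_finrank_ker (hβ : ∀ i, Function.Injective (β i))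
    (he : ∀ i, Function.Injective (e i)) (f : L[X]) (i : Fin t) :
    n i ≤ (encode T β e f i).rank + finrank F (LinearMap.ker (skewEval (T i) f)) := by
  have hker : finrank F (LinearMap.ker (e i ∘ₗ skewEval (T i) f ∘ₗ β i)) ≤
      finrank F (LinearMap.ker (skewEval (T i) f)) := by
    rw [LinearMap.ker_comp_of_ker_eq_bot _ (LinearMap.ker_eq_bot.mpr (he i)), LinearMap.ker_comp]
    have hcomap := finrank_comap_le (β i) (LinearMap.ker (skewEval (T i) f))
    rwa [LinearMap.ker_eq_bot.mpr (hβ i), finrank_bot, add_zero] at hcomap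
  rw [encode_apply, Matrix.rank, ← Matrix.toLin'_apply', Matrix.toLin'_toMatrix']
  calc n i = finrank F (Fin (n i) → F) := (finrank_fin_fun F).symm
    _ = _ := (LinearMap.finrank_range_add_finrank_ker _).symm
    _ ≤ _ := Nat.add_le_add_left hker _

theorem RootBounded.lt_srk_encode_add (hT : RootBounded T) (hβ : ∀ i, Function.Injective (β i))
    (he : ∀ i, Function.Injective (e i)) {K : ℕ} {f : L[X]} (hf : f ∈ degreeLT L K) (hf0 : f ≠ 0) :
    ∑ i, n i < srk (encode T β e f) + K := by
  have hdeg : f.natDegree < K := (natDegree_lt_iff_degree_lt hf0).mpr (mem_degreeLT.mp hf)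
  calc ∑ i, n i
      ≤ ∑ i, ((encode T β e f i).rank + finrank F (LinearMap.ker (skewEval (T i) f))) :=
        Finset.sum_le_sum fun i _ => le_rank_encode_add_finrank_ker hβ he f i
    _ ≤ srk (encode T β e f) + f.natDegree := by
        rw [Finset.sum_add_distrib]
        exact Nat.add_le_add_left (hT f hf0) _
    _ < srk (encode T β e f) + K := Nat.add_lt_add_left hdeg _

theorem RootBounded.encode_ne_zero (hT : RootBounded T) (hβ : ∀ i, Function.Injective (β i))
    (he : ∀ i, Function.Injective (e i)) {K : ℕ} (hK : K ≤ ∑ i, n i) {f : L[X]}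
    (hf : f ∈ degreeLT L K) (hf0 : f ≠ 0) : encode T β e f ≠ 0 := by
  intro h
  have hlt := hT.lt_srk_encode_add hβ he hf hf0
  have hsrk : srk (0 : Ambient F m n) = 0 := by simp [srk]
  rw [h, hsrk] at hlt
  omega

theorem RootBounded.minDist_skewEvalCode_add (hT : RootBounded T)
    (hβ : ∀ i, Function.Injective (β i)) (he : ∀ i, Function.Injective (e i))
    {K : ℕ} (hK0 : 0 < K) (hK : K ≤ ∑ i, n i) :
    minDist (skewEvalCode T β e K) + K = ∑ i, n i + 1 := by
  rw [minDist_eq_of_le (w := ∑ i, n i + 1 - K), Nat.sub_add_cancel (hK.trans (Nat.le_succ _))]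
  · rintro _ ⟨f, hf, rfl⟩ hf0
    have hlt := hT.lt_srk_encode_add hβ he hf (by rintro rfl; exact hf0 (map_zero _))
    omega
  · obtain ⟨f, hf, hf0, hle⟩ := exists_srk_encode_add_le T β e hK0 hK
    exact ⟨_, ⟨f, hf, rfl⟩, hT.encode_ne_zero hβ he hK hf hf0, by omega⟩

theorem RootBounded.finrank_skewEvalCode (hT : RootBounded T)
    (hβ : ∀ i, Function.Injective (β i)) (he : ∀ i, Function.Injective (e i))
    {K : ℕ} (hK : K ≤ ∑ i, n i) :
    finrank F (skewEvalCode T β e K) = finrank F L * K := by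
  have hinj :
      LinearMap.ker ((encode T β e).domRestrict ((degreeLT L K).restrictScalars F)) = ⊥ := by
    refine LinearMap.ker_eq_bot'.mpr fun ⟨f, hf⟩ hf0 => ?_
    by_contra hne
    exact hT.encode_ne_zero hβ he hK hf (fun h => hne (Subtype.ext h)) hf0
  calc finrank F (skewEvalCode T β e K)
      = finrank F (degreeLT L K) := by
        rw [skewEvalCode, ← LinearMap.range_domRestrict,
          LinearMap.finrank_range_of_inj (LinearMap.ker_eq_bot.mp hinj)]
        rfl
    _ = finrank F L * finrank L (degreeLT L K) := (finrank_mul_finrank F L _).symm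
    _ = finrank F L * K := by rw [(degreeLTEquiv L K).finrank_eq, finrank_fin_fun]

theorem RootBounded.isMSRD_skewEvalCode (hT : RootBounded T)
    (hβ : ∀ i, Function.Injective (β i)) (he : ∀ i, Function.Injective (e i)) {j : Fin t}
    (hm : ∀ i, j ≤ i → m i = finrank F L) {K : ℕ} (hK0 : 0 < K)
    (hK : K + ∑ i ∈ Finset.Iio j, n i ≤ ∑ i, n i) : IsMSRD (skewEvalCode T β e K) := by
  have hdist := hT.minDist_skewEvalCode_add hβ he hK0 (by omega)
  refine isMSRD_of_finrank_add_mul_minDist hm (by omega) (by omega) ?_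
  rw [hT.finrank_skewEvalCode hβ he (by omega), ← mul_add, add_comm K, hdist]

end SkewEvalCode

section FiniteField

theorem SkewConj.norm_eq {F L : Type*} [Field F] [Field L] [Algebra F L] [Module.Finite F L]
    {σ : L →ₐ[F] L} {a b : L} (h : SkewConj σ a b) : Algebra.norm F a = Algebra.norm F b := by
  obtain ⟨c, hc, hab⟩ := h
  have hσc : Algebra.norm F (σ c) = Algebra.norm F c :=
    Algebra.norm_eq_of_algEquiv (AlgEquiv.ofBijective σ σ.bijective) c
  have hnorm := congrArg (Algebra.norm F) hab
  rw [map_mul, map_mul, hσc] at hnorm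
  exact mul_right_cancel₀ (Algebra.norm_ne_zero_iff.mpr hc) hnorm

theorem exists_pairwise_not_skewConj {F L : Type*} [Field F] [Fintype F] [Field L] [Algebra F L]
    [Finite L] (σ : L →ₐ[F] L) {ι : Type*} [Fintype ι] (hι : Fintype.card ι < Fintype.card F) :
    ∃ a : ι → L, (∀ i, a i ≠ 0) ∧ Pairwise fun i j => ¬ SkewConj σ (a i) (a j) := by
  classical
  obtain ⟨u⟩ : Nonempty (ι ↪ Fˣ) := Function.Embedding.nonempty_of_card_le (by
    rw [Fintype.card_units]
    omega)
  choose a ha using fun i => FiniteField.norm_surjective F L (u i : F)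
  refine ⟨a, fun i h => (u i).ne_zero ?_, fun i j hij h => hij (u.injective (Units.ext ?_))⟩
  · rw [← ha i, h, Algebra.norm_zero]
  · rw [← ha i, ← ha j, h.norm_eq]

theorem exists_extension_fixed_eq_base (F : Type*) [Field F] [Finite F] {M : ℕ} (hM : 0 < M) :
    ∃ (L : Type) (_ : Field L) (_ : Algebra F L) (_ : Finite L) (σ : L →ₐ[F] L),
      finrank F L = M ∧ ∀ x, σ x = x → x ∈ Set.range (algebraMap F L) := by
  obtain ⟨p, hp⟩ := CharP.exists F
  have : Fact p.Prime := ⟨CharP.char_is_prime F p⟩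
  have : NeZero M := ⟨hM.ne'⟩
  refine ⟨FiniteField.Extension F p M, inferInstance, inferInstance, inferInstance,
    (FiniteField.Extension.frob F p M : _ →ₐ[F] _), FiniteField.finrank_extension F p M,
    fun x hx => (IsGalois.mem_range_algebraMap_iff_fixed x).mpr fun g => ?_⟩
  obtain ⟨k, -, rfl⟩ := FiniteField.Extension.exists_frob_pow_eq F p M g
  rw [AlgEquiv.coe_pow]
  exact Function.IsFixedPt.iterate hx k

theorem exists_rootBounded (F : Type*) [Field F] [Fintype F] {ι : Type*} [Fintype ι]
    (hι : Fintype.card ι < Fintype.card F) {M : ℕ} (hM : 0 < M) :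
    ∃ (L : Type) (_ : Field L) (_ : Algebra F L) (_ : Module.Finite F L)
      (T : ι → Module.End F L), finrank F L = M ∧ RootBounded T := by
  obtain ⟨L, _, _, _, σ, hfin, hσ⟩ := exists_extension_fixed_eq_base F hM
  obtain ⟨a, ha0, ha⟩ := exists_pairwise_not_skewConj σ hι
  exact ⟨L, inferInstance, inferInstance, inferInstance, _, hfin, rootBounded_skewOp hσ ha0 ha⟩

end FiniteField

end SumRank

theorem proposition4p11 {F : Type*} [Field F] [Fintype F] (t : ℕ) (ht : 0 < t)
    (m n : Fin t → ℕ) (hn : ∀ i, 0 < n i) (hm : Antitone m)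
    (hnm : ∀ i, n i ≤ m ⟨t - 1, Nat.sub_one_lt_of_lt ht⟩)
    (hq : t < Fintype.card F)
    (j : Fin t) (hj : IsLeast {i : Fin t | m i = m ⟨t - 1, Nat.sub_one_lt_of_lt ht⟩} j)
    (d : ℕ) (hd : d = (∑ i ∈ Finset.Iio j, n i) + 1) :
    ∃ C : ℕ → Submodule F (SumRank.Ambient F m n),
      AntitoneOn C (Set.Icc d (∑ i, n i)) ∧
      ∀ i ∈ Set.Icc d (∑ i, n i),
        SumRank.IsMSRD (C i) ∧ SumRank.minDist (C i) = i := by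
  have hlast (i : Fin t) : m ⟨t - 1, Nat.sub_one_lt_of_lt ht⟩ ≤ m i :=
    hm (Fin.le_def.mpr (Nat.le_sub_one_of_lt i.isLt))
  obtain ⟨L, _, _, _, T, hL, hT⟩ :=
    SumRank.exists_rootBounded F ((Fintype.card_fin t).trans_lt hq) ((hn ⟨0, ht⟩).trans_le (hnm _))
  rw [← hL] at hj hnm hlast
  choose β hβ using fun i => finrank_le_iff_exists_linearMap.mp
    ((Module.finrank_fin_fun F).trans_le (hnm i))
  choose e he using fun i => finrank_le_iff_exists_linearMap.mp
    ((hlast i).trans_eq (Module.finrank_fin_fun F).symm)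
  refine ⟨fun i => SumRank.skewEvalCode T β e (∑ i, n i + 1 - i), fun i _ k _ hik =>
    SumRank.skewEvalCode_mono (Nat.sub_le_sub_left hik _), fun i ⟨hdi, hin⟩ => ⟨?_, ?_⟩⟩
  · exact hT.isMSRD_skewEvalCode hβ he (fun k hk => ((hm hk).trans_eq hj.1).antisymm (hlast k))
      (by omega) (by omega)
  · have := hT.minDist_skewEvalCode_add hβ he (K := ∑ i, n i + 1 - i) (by omega) (by omega)
    dsimp only
    omega
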